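/- Let $f:\mathbb R^n\to(-\infty,+\infty]$ and $g:\mathbb R^m\to(-\infty,+\infty]$ be proper closed convex functions, let $K\in\mathbb R^{m\times n}$, let $g^*(y)=\sup_{z}\{\langle z,y\rangle-g(z)\}$, and put $\mathcal L(x,y)=f(x)+\langle Kx,y\rangle-g^*(y)$. Assume that the problem $\min_x\max_y\mathcal L(x,y)$ has a saddle point, i.e. a pair $(x^\star,y^\star)$ with $\mathcal L(x^\star,y)\le\mathcal L(x^\star,y^\star)\le\mathcal L(x,y^\star)$ for all $x\in\mathbb R^n$, $y\in\mathbb R^m$. Let $\Sigma_f\in\mathbb R^{n\times n}$ be a symmetric positive semidefinite matrix such that $\langle\xi_1-\xi_2,x_1-x_2\rangle\ge\|x_1-x_2\|_{\Sigma_f}^2$ whenever $\xi_1\in\partial f(x_1)$ and $\xi_2\in\partial f(x_2)$, where $\|z\|_M^2:=\langle z,Mz\rangle$ for a symmetric matrix $M$. Let $M_1\in\mathbb R^{n\times n}$ and $M_2\in\mathbb R^{m\times m}$ be symmetric matrices with $$M_1+\tfrac12\Sigma_f\succ0,\qquad M_2\succ0,\qquad \Big\|M_2^{-1/2}K\big(M_1+\tfrac12\Sigma_f\big)^{-1/2}\Big\|^2<\tfrac43,$$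 where $\|\cdot\|$ is the spectral norm. Let $\{(x^k,y^k)\}_{k\ge0}$ be a sequence generated by PrePDHG from an arbitrary initial point $(x^0,y^0)\in\mathbb R^n\times\mathbb R^m$: $$x^{k+1}=\operatorname*{argmin}_{x\in\mathbb R^n}\ f(x)+\langle Kx,y^k\rangle+\tfrac12\|x-x^k\|_{M_1}^2,$$ $$y^{k+1}=\operatorname*{argmin}_{y\in\mathbb R^m}\ g^*(y)-\langle K(2x^{k+1}-x^k),y\rangle+\tfrac12\|y-y^k\|_{M_2}^2.$$ The iteration may also be stopped at an iterate $(x^k,y^k)$, $k\ge1$, at which the KKT residual $\max\{\operatorname{dist}(0,\partial f(x^k)+K^{\mathsf T}y^k),\operatorname{dist}(0,\partial g^*(y^k)-Kx^k)\}$ is $0$ (the distance to the empty set being $+\infty$), in which case the sequence is continued by its last term. Then $\{(x^k,y^k)\}$ converges to a saddle point of $\min_x\max_y\mathcal L(x,y)$. -/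

import Mathlib

open Filter Topology
open scoped ENNReal NNReal MatrixOrder

noncomputable section

namespace PrePDHG

/-- `ℝⁿ` with its standard inner product and the `ℓ₂` norm. -/
abbrev Vec (n : ℕ) : Type := EuclideanSpace ℝ (Fin n)

/-- The matrix-vector product `A z`. -/
def act {m n : ℕ} (A : Matrix (Fin m) (Fin n) ℝ) (z : Vec n) : Vec m :=
  Matrix.toEuclideanLin A z

/-- `‖z‖_M² = ⟨z, M z⟩` (it may be negative when `M` is indefinite). -/
def normSqM {n : ℕ} (M : Matrix (Fin n) (Fin n) ℝ) (z : Vec n) : ℝ :=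
  inner ℝ z (act M z)

/-- `M^{-1/2}`, the positive semidefinite square root of `M⁻¹` (used for `M ≻ 0`). -/
def invSqrt {n : ℕ} (M : Matrix (Fin n) (Fin n) ℝ) : Matrix (Fin n) (Fin n) ℝ :=
  CFC.sqrt M⁻¹

theorem invSqrt_posSemidef {n : ℕ} (M : Matrix (Fin n) (Fin n) ℝ) :
    (invSqrt M).PosSemidef :=
  Matrix.nonneg_iff_posSemidef.mp (CFC.sqrt_nonneg M⁻¹)

theorem invSqrt_mul_self {n : ℕ} {M : Matrix (Fin n) (Fin n) ℝ} (hM : M.PosDef) :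
    invSqrt M * invSqrt M = M⁻¹ :=
  CFC.sqrt_mul_sqrt_self M⁻¹ hM.inv.posSemidef.nonneg

/-- The spectral norm of a matrix, i.e. its operator norm for the `ℓ₂` norms. -/
def spectralNorm {m n : ℕ} (A : Matrix (Fin m) (Fin n) ℝ) : ℝ :=
  ‖LinearMap.toContinuousLinearMap (Matrix.toEuclideanLin A)‖

/-- Proper closed convex functions `f : ℝⁿ → (-∞, +∞]`. Convexity is convexity of the epigraph,
closedness is lower semicontinuity. -/
structure ProperClosedConvex {n : ℕ} (f : Vec n → EReal) : Prop where
  ne_bot : ∀ x, f x ≠ ⊥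
  exists_ne_top : ∃ x, f x ≠ ⊤
  closed : LowerSemicontinuous f
  convex : Convex ℝ {p : Vec n × ℝ | f p.1 ≤ (p.2 : EReal)}

/-- The convex conjugate `g*(y) = sup_z {⟨z, y⟩ - g(z)}`. -/
def conj {m : ℕ} (g : Vec m → EReal) (y : Vec m) : EReal :=
  ⨆ z : Vec m, ((inner ℝ z y : ℝ) : EReal) - g z

/-- The subdifferential `∂f(x)`; it is empty outside the domain of `f`. -/
def subdiff {n : ℕ} (f : Vec n → EReal) (x : Vec n) : Set (Vec n) :=
  {ξ | f x ≠ ⊤ ∧ ∀ z, f x + ((inner ℝ ξ (z - x) : ℝ) : EReal) ≤ f z}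

/-- `S` is a matrix `Σ_f` for `f`: a symmetric positive semidefinite matrix such that
`⟨ξ₁ - ξ₂, x₁ - x₂⟩ ≥ ‖x₁ - x₂‖_S²` for all `ξ₁ ∈ ∂f(x₁)` and `ξ₂ ∈ ∂f(x₂)`. -/
structure IsMonotonicityMatrix {n : ℕ} (f : Vec n → EReal)
    (S : Matrix (Fin n) (Fin n) ℝ) : Prop where
  posSemidef : S.PosSemidef
  monotone : ∀ x₁ x₂ ξ₁ ξ₂ : Vec n, ξ₁ ∈ subdiff f x₁ → ξ₂ ∈ subdiff f x₂ →
    normSqM S (x₁ - x₂) ≤ inner ℝ (ξ₁ - ξ₂) (x₁ - x₂)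

/-- The objective `ℒ(x, y) = f(x) + ⟨K x, y⟩ - g*(y)` of the min-max problem. -/
def lagrangian {m n : ℕ} (f : Vec n → EReal) (g : Vec m → EReal)
    (K : Matrix (Fin m) (Fin n) ℝ) (x : Vec n) (y : Vec m) : EReal :=
  f x + ((inner ℝ (act K x) y : ℝ) : EReal) - conj g y

/-- `(xs, ys)` is a saddle point: `ℒ(xs, y) ≤ ℒ(xs, ys) ≤ ℒ(x, ys)` for all `x` and `y`.
For proper `f` and `g*` these inequalities force `f(xs)` and `g*(ys)` to be finite, so none of the
values that occur is of the form `∞ - ∞`. -/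
def IsSaddle {m n : ℕ} (f : Vec n → EReal) (g : Vec m → EReal)
    (K : Matrix (Fin m) (Fin n) ℝ) (xs : Vec n) (ys : Vec m) : Prop :=
  (∀ y, lagrangian f g K xs y ≤ lagrangian f g K xs ys) ∧
    ∀ x, lagrangian f g K xs ys ≤ lagrangian f g K x ys

/-- The KKT residual `max {dist(0, ∂f(x) + Kᵀ y), dist(0, ∂g*(y) - K x)}`; the distance to the
empty set is `∞`. -/
def kktResidual {m n : ℕ} (f : Vec n → EReal) (g : Vec m → EReal)
    (K : Matrix (Fin m) (Fin n) ℝ) (x : Vec n) (y : Vec m) : ℝ≥0∞ :=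
  max (Metric.infEDist 0 ((fun ξ => ξ + act K.transpose y) '' subdiff f x))
    (Metric.infEDist 0 ((fun η => η - act K x) '' subdiff (conj g) y))

/-- One update of PrePDHG from `(x, y)` to `(x', y')`:
`x' ∈ argmin_z f(z) + ⟨K z, y⟩ + ½ ‖z - x‖_{M₁}²` and
`y' ∈ argmin_w g*(w) - ⟨K (2 x' - x), w⟩ + ½ ‖w - y‖_{M₂}²`. -/
structure IsStep {m n : ℕ} (f : Vec n → EReal) (g : Vec m → EReal)
    (K : Matrix (Fin m) (Fin n) ℝ) (M₁ : Matrix (Fin n) (Fin n) ℝ) (M₂ : Matrix (Fin m) (Fin m) ℝ)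
    (x : Vec n) (y : Vec m) (x' : Vec n) (y' : Vec m) : Prop where
  primal : IsMinOn (fun z : Vec n =>
    f z + ((inner ℝ (act K z) y + (1 / 2) * normSqM M₁ (z - x) : ℝ) : EReal)) Set.univ x'
  dual : IsMinOn (fun w : Vec m =>
    conj g w + ((-inner ℝ (act K ((2 : ℝ) • x' - x)) w
      + (1 / 2) * normSqM M₂ (w - y) : ℝ) : EReal)) Set.univ y'

/-- `(x k, y k)`, `k = 0, 1, …`, is generated by PrePDHG with tolerance `ε`: every new pair comes
from an update, except that the method may stop at a computed iterate (`k ≥ 1`) whose KKT residual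
is at most `ε`, and a stopped run is continued by its last iterate. The update rule carried on
forever and the run with the stopping test are both of this form. -/
def IsGenerated {m n : ℕ} (f : Vec n → EReal) (g : Vec m → EReal)
    (K : Matrix (Fin m) (Fin n) ℝ) (M₁ : Matrix (Fin n) (Fin n) ℝ) (M₂ : Matrix (Fin m) (Fin m) ℝ)
    (ε : ℝ≥0) (x : ℕ → Vec n) (y : ℕ → Vec m) : Prop :=
  ∀ k, IsStep f g K M₁ M₂ (x k) (y k) (x (k + 1)) (y (k + 1)) ∨
    (1 ≤ k ∧ kktResidual f g K (x k) (y k) ≤ (ε : ℝ≥0∞) ∧ x (k + 1) = x k ∧ y (k + 1) = y k)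

end PrePDHG

end

/-! Put P = M₁ + S/2, R = M₂⁻¹K and T = KᵀM₂⁻¹K. Saddle points are the zeros of the monotone KKT
inclusion (`isSaddle_iff`), and each iteration, stopped or not, solves a preconditioned form of it
(`IsGenerated.inclusions`). The spectral condition says T ≤ cP with c < 4/3 (`inner_actL_inv_le`).

The dual variable to follow is the shifted one, l = y + R(x⁺ - x). Besides monotonicity against a
saddle point, the estimate uses monotonicity of ∂f between two successive primal iterates, with
weight 1/2. Completing the square in the dual terms then gives the decrease of an energy
(`energy_descent`), whose primal part is at least (1/6 - c/8)‖x⁺⁺ - x⁺‖_P²; this is where 4/3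
enters.

The energy is coercive (`energy_lower_bound`), so the iterates are bounded and successive
differences vanish. Since subdifferential graphs are closed, a cluster point is a saddle point. The
energy measured from that point decreases and tends to 0 along a subsequence, hence along the whole
sequence. -/

noncomputable section

namespace PrePDHG

/-! ### Energy estimate and convergence for monotone inclusions -/

section Convergence

variable {E F : Type*} [NormedAddCommGroup E] [InnerProductSpace ℝ E]
  [NormedAddCommGroup F] [InnerProductSpace ℝ F]

/-- The Lyapunov function of PrePDHG at the errors `p₀, p₁` of two successive primal iterates and
the error `b` of the dual iterate. -/
def energy (P S : E →L[ℝ] E) (M : F →L[ℝ] F) (K R : E →L[ℝ] F) (p₀ p₁ : E) (b : F) : ℝ :=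
  1 / 2 * inner ℝ (b + R (p₁ - p₀)) (M (b + R (p₁ - p₀)))
    + 1 / 2 * (inner ℝ p₁ (P p₁) + 1 / 2 * inner ℝ p₁ (S p₁))
    + 1 / 4 * (5 / 3 * inner ℝ (p₁ - p₀) (P (p₁ - p₀)) + 1 / 2 * inner ℝ (p₁ - p₀) (S (p₁ - p₀))
      - inner ℝ (K (p₁ - p₀)) (R (p₁ - p₀)))

theorem energy_descent {P S : E →L[ℝ] E} {M : F →L[ℝ] F} {K R : E →L[ℝ] F}
    (hPs : ∀ u v, inner ℝ u (P v) = inner ℝ v (P u))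
    (hSs : ∀ u v, inner ℝ u (S v) = inner ℝ v (S u))
    (hMs : ∀ u v, inner ℝ u (M v) = inner ℝ v (M u))
    (hR : ∀ u, M (R u) = K u)
    (hP : ∀ u, 0 ≤ inner ℝ u (P u)) (hS : ∀ u, 0 ≤ inner ℝ u (S u))
    (hT : ∀ u, inner ℝ (K u) (R u) ≤ 4 / 3 * inner ℝ u (P u))
    {p₀ p₁ p₂ : E} {b₀ b₁ : F}
    (h₁ : inner ℝ p₂ (S p₂) ≤ -inner ℝ b₁ (K p₂)
      - (inner ℝ p₂ (P (p₂ - p₁)) - 1 / 2 * inner ℝ p₂ (S (p₂ - p₁))))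
    (h₂ : 0 ≤ inner ℝ (K ((2 : ℝ) • p₁ - p₀)) b₁ - inner ℝ b₁ (M (b₁ - b₀)))
    (h₃ : inner ℝ (p₂ - p₁) (S (p₂ - p₁)) ≤ -inner ℝ (b₁ - b₀) (K (p₂ - p₁))
      - (inner ℝ (p₂ - p₁) (P (p₂ - p₁ - (p₁ - p₀)))
        - 1 / 2 * inner ℝ (p₂ - p₁) (S (p₂ - p₁ - (p₁ - p₀))))) :
    1 / 2 * inner ℝ (b₀ + R (p₁ - p₀) - (b₁ + R (p₂ - p₁)) + (1 / 2 : ℝ) • R (p₂ - p₁))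
        (M (b₀ + R (p₁ - p₀) - (b₁ + R (p₂ - p₁)) + (1 / 2 : ℝ) • R (p₂ - p₁)))
      + (1 / 6 * inner ℝ (p₂ - p₁) (P (p₂ - p₁)) - 1 / 8 * inner ℝ (K (p₂ - p₁)) (R (p₂ - p₁)))
      ≤ energy P S M K R p₀ p₁ b₀ - energy P S M K R p₁ p₂ b₁ := by
  -- The claim is `h₁ + h₂ + h₃/2` together with `q₁/12 + q₂/8 + q₃/4 + q₄/4`. The half weight on
  -- `h₃` produces the shift `(1/2) • R (p₂ - p₁)` in the completed square. `q₃` trades the T-norm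
  -- of the second difference for its P-norm; `q₁` and `q₂` remove the remaining cross terms of
  -- consecutive differences.
  have q₁ := hP (p₂ - p₁ + (p₁ - p₀))
  have q₂ := hS (p₂ - p₁ + (p₁ - p₀))
  have q₃ := hT (p₂ - p₁ - (p₁ - p₀))
  have q₄ := hS (p₂ + p₁)
  have hTs : ∀ u v, inner ℝ (K u) (R v) = inner ℝ (K v) (R u) := fun u v => by
    rw [← hR, ← hR, real_inner_comm, hMs, real_inner_comm]
  have hRM : ∀ u w, inner ℝ (R u) (M w) = inner ℝ w (K u) := fun u w => by rw [hMs, hR]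
  have hRK : ∀ u v, inner ℝ (R u) (K v) = inner ℝ (K v) (R u) := fun u v => real_inner_comm _ _
  have hKb : ∀ u w, inner ℝ (K u) w = inner ℝ w (K u) := fun u w => real_inner_comm _ _
  unfold energy
  simp only [map_sub, map_add, map_smul, inner_sub_left, inner_sub_right, inner_add_left,
    inner_add_right, inner_smul_left, inner_smul_right, hR, hRM, RCLike.conj_to_real]
    at h₁ h₂ h₃ q₁ q₂ q₃ q₄ ⊢
  simp only [hRK, hKb _ b₁] at h₁ h₂ h₃ q₁ q₂ q₃ q₄ ⊢
  have t₁ := hTs p₀ p₁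
  have t₂ := hTs p₀ p₂
  have t₃ := hTs p₁ p₂
  have s₁ := hSs p₀ p₁
  have s₂ := hSs p₀ p₂
  have s₃ := hSs p₁ p₂
  have r₁ := hPs p₀ p₁
  have r₂ := hPs p₀ p₂
  have r₃ := hPs p₁ p₂
  have m₁ := hMs b₀ b₁
  linarith

/-- The coefficient 5/3 exceeds 4/3, so the bracket in the primal difference stays nonnegative
although T enters with a minus sign. -/
theorem energy_lower_bound {P S : E →L[ℝ] E} {M : F →L[ℝ] F} {K R : E →L[ℝ] F} {μ : ℝ} (hμ : 0 ≤ μ)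
    (hP : ∀ u, μ * ‖u‖ ^ 2 ≤ inner ℝ u (P u)) (hM : ∀ w, μ * ‖w‖ ^ 2 ≤ inner ℝ w (M w))
    (hS : ∀ u, 0 ≤ inner ℝ u (S u))
    (hT : ∀ u, inner ℝ (K u) (R u) ≤ 4 / 3 * inner ℝ u (P u)) (p₀ p₁ : E) (b : F) :
    μ / 2 * ‖b + R (p₁ - p₀)‖ ^ 2 + μ / 2 * ‖p₁‖ ^ 2 ≤ energy P S M K R p₀ p₁ b := by
  have h₁ := hM (b + R (p₁ - p₀))
  have h₂ := hP p₁
  have h₃ := hS p₁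
  have h₄ := hS (p₁ - p₀)
  have h₅ := hT (p₁ - p₀)
  have h₆ := hP (p₁ - p₀)
  have h₇ : 0 ≤ μ * ‖p₁ - p₀‖ ^ 2 := by positivity
  unfold energy
  linarith

theorem tendsto_zero_of_mul_sq_le {G : Type*} [NormedAddCommGroup G] {v : ℕ → G} {a : ℕ → ℝ}
    {c : ℝ} (hc : 0 < c) (h : ∀ k, c * ‖v k‖ ^ 2 ≤ a k) (ha : Tendsto a atTop (𝓝 0)) :
    Tendsto v atTop (𝓝 0) := by
  have h₁ : Tendsto (fun k => ‖v k‖ ^ 2) atTop (𝓝 0) := by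
    refine squeeze_zero (fun k => by positivity) (g := fun k => c⁻¹ * a k) (fun k => ?_)
      (by simpa using ha.const_mul c⁻¹)
    rw [le_inv_mul_iff₀ hc]
    exact h k
  have h₂ := h₁.sqrt
  simp only [Real.sqrt_sq (norm_nonneg _), Real.sqrt_zero] at h₂
  exact tendsto_zero_iff_norm_tendsto_zero.mpr h₂

/-- Convergence of the preconditioned primal-dual iteration for two monotone operators, given by
their graphs `A` and `B`. The preconditioners are `P - S / 2` and `M`, and `R = M⁻¹ K`. -/
theorem tendsto_of_monotone_inclusion [FiniteDimensional ℝ E] [FiniteDimensional ℝ F]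
    {A : Set (E × E)} {B : Set (F × F)} (hA : IsClosed A) (hB : IsClosed B)
    {P S : E →L[ℝ] E} {M : F →L[ℝ] F} {K R : E →L[ℝ] F} {Kt : F →L[ℝ] E}
    (hAmono : ∀ p ∈ A, ∀ q ∈ A,
      inner ℝ (p.1 - q.1) (S (p.1 - q.1)) ≤ inner ℝ (p.2 - q.2) (p.1 - q.1))
    (hBmono : ∀ p ∈ B, ∀ q ∈ B, 0 ≤ inner ℝ (p.2 - q.2) (p.1 - q.1))
    (hKt : ∀ u w, inner ℝ (Kt w) u = inner ℝ w (K u))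
    (hPs : ∀ u v, inner ℝ u (P v) = inner ℝ v (P u))
    (hSs : ∀ u v, inner ℝ u (S v) = inner ℝ v (S u))
    (hMs : ∀ u v, inner ℝ u (M v) = inner ℝ v (M u))
    (hR : ∀ u, M (R u) = K u) {μ c : ℝ} (hμ : 0 < μ) (hc : c < 4 / 3)
    (hP : ∀ u, μ * ‖u‖ ^ 2 ≤ inner ℝ u (P u)) (hM : ∀ w, μ * ‖w‖ ^ 2 ≤ inner ℝ w (M w))
    (hS : ∀ u, 0 ≤ inner ℝ u (S u))
    (hT : ∀ u, inner ℝ (K u) (R u) ≤ c * inner ℝ u (P u))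
    (hzero : ∃ xs ys, (xs, -Kt ys) ∈ A ∧ (ys, K xs) ∈ B) {x : ℕ → E} {y : ℕ → F}
    (hx : ∀ k, (x (k + 1),
      -Kt (y k) - (P (x (k + 1) - x k) - (1 / 2 : ℝ) • S (x (k + 1) - x k))) ∈ A)
    (hy : ∀ k, (y (k + 1),
      K ((2 : ℝ) • x (k + 1) - x k) - M (y (k + 1) - y k)) ∈ B) :
    ∃ xs ys, ((xs, -Kt ys) ∈ A ∧ (ys, K xs) ∈ B) ∧
      Tendsto x atTop (𝓝 xs) ∧ Tendsto y atTop (𝓝 ys) := by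
  have hP0 : ∀ u, 0 ≤ inner ℝ u (P u) := fun u => le_trans (by positivity) (hP u)
  have hT' : ∀ u, inner ℝ (K u) (R u) ≤ 4 / 3 * inner ℝ u (P u) := fun u =>
    (hT u).trans (mul_le_mul_of_nonneg_right hc.le (hP0 u))
  let l : ℕ → F := fun k => y k + R (x (k + 1) - x k)
  let V : E → F → ℕ → ℝ := fun xs ys k =>
    energy P S M K R (x k - xs) (x (k + 1) - xs) (y k - ys)
  have hVlow : ∀ xs ys k,
      μ / 2 * ‖l k - ys‖ ^ 2 + μ / 2 * ‖x (k + 1) - xs‖ ^ 2 ≤ V xs ys k := fun xs ys k => by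
    have h := energy_lower_bound hμ.le hP hM hS hT' (x k - xs) (x (k + 1) - xs) (y k - ys)
    rwa [sub_sub_sub_cancel_right, sub_add_eq_add_sub] at h
  have hV0 : ∀ xs ys k, 0 ≤ V xs ys k := fun xs ys k => le_trans (by positivity) (hVlow xs ys k)
  have hdesc : ∀ xs ys, (xs, -Kt ys) ∈ A → (ys, K xs) ∈ B → ∀ k,
      μ / 2 * ‖l k - l (k + 1) + (1 / 2 : ℝ) • R (x (k + 2) - x (k + 1))‖ ^ 2
        + (1 / 6 - c / 8) * μ * ‖x (k + 2) - x (k + 1)‖ ^ 2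
        ≤ V xs ys k - V xs ys (k + 1) := by
    intro xs ys hxs hys k
    -- The dual update k is paired with the primal update k + 1, the one that uses the new dual
    -- iterate.
    have hx₂ : (x (k + 2), -Kt (y (k + 1))
        - (P (x (k + 2) - x (k + 1)) - (1 / 2 : ℝ) • S (x (k + 2) - x (k + 1)))) ∈ A := hx (k + 1)
    have h₁ := hAmono _ hx₂ _ hxs
    have h₂ := hBmono _ (hy k) _ hys
    have h₃ := hAmono _ hx₂ _ (hx k)
    dsimp only at h₁ h₂ h₃
    have key := energy_descent hPs hSs hMs hR hP0 hS hT'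
      (p₀ := x k - xs) (p₁ := x (k + 1) - xs) (p₂ := x (k + 2) - xs)
      (b₀ := y k - ys) (b₁ := y (k + 1) - ys)
      (by
        simp only [sub_sub_sub_cancel_right]
        refine h₁.trans_eq ?_
        generalize x (k + 2) - xs = v
        simp only [inner_sub_left, inner_neg_left, hKt, real_inner_smul_left]
        rw [real_inner_comm v (P _), real_inner_comm v (S _)]
        ring)
      (by
        rw [show (2 : ℝ) • (x (k + 1) - xs) - (x k - xs) = (2 : ℝ) • x (k + 1) - x k - xs by
          module, sub_sub_sub_cancel_right, map_sub K]
        refine h₂.trans_eq ?_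
        rw [real_inner_comm (M _), ← inner_sub_left]
        rw [sub_right_comm])
      (by
        simp only [sub_sub_sub_cancel_right]
        refine h₃.trans_eq ?_
        generalize x (k + 2) - x (k + 1) = v
        generalize x (k + 1) - x k = d
        simp only [map_sub P, map_sub S, inner_sub_right, inner_sub_left, inner_neg_left, hKt,
          real_inner_smul_left]
        rw [real_inner_comm v (P _), real_inner_comm v (P _), real_inner_comm v (S _),
          real_inner_comm v (S _)]
        ring)
    refine le_trans ?_ key
    have e₁ := hM (l k - l (k + 1) + (1 / 2 : ℝ) • R (x (k + 2) - x (k + 1)))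
    have e₂ := hP (x (k + 2) - x (k + 1))
    have e₃ := hT (x (k + 2) - x (k + 1))
    simp only [sub_sub_sub_cancel_right]
    rw [show y k - ys + R (x (k + 1) - x k) - (y (k + 1) - ys + R (x (k + 2) - x (k + 1)))
      = l k - l (k + 1) by simp only [l]; abel]
    have e₄ := mul_le_mul_of_nonneg_left e₂ (show 0 ≤ 1 / 6 - c / 8 by linarith)
    linarith
  have hanti : ∀ xs ys, (xs, -Kt ys) ∈ A → (ys, K xs) ∈ B → Antitone (V xs ys) :=
    fun xs ys hxs hys => antitone_nat_of_succ_le fun k => by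
      have h := hdesc xs ys hxs hys k
      have h' : 0 < 1 / 6 - c / 8 := by linarith
      have : 0 ≤ V xs ys k - V xs ys (k + 1) := le_trans (by positivity) h
      linarith
  have hlim : ∀ xs ys, (xs, -Kt ys) ∈ A → (ys, K xs) ∈ B → ∃ a, Tendsto (V xs ys) atTop (𝓝 a) :=
    fun xs ys hxs hys => ⟨_, tendsto_atTop_ciInf (hanti xs ys hxs hys)
      ⟨0, by rintro _ ⟨k, rfl⟩; exact hV0 xs ys k⟩⟩
  obtain ⟨x₀, y₀, hx₀, hy₀⟩ := hzero
  have hdiff : Tendsto (fun k => V x₀ y₀ k - V x₀ y₀ (k + 1)) atTop (𝓝 0) := by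
    obtain ⟨a, ha⟩ := hlim x₀ y₀ hx₀ hy₀
    simpa using ha.sub (ha.comp (tendsto_add_atTop_nat 1))
  have hκ : 0 < (1 / 6 - c / 8) * μ := mul_pos (by linarith) hμ
  have hd' : Tendsto (fun k => x (k + 2) - x (k + 1)) atTop (𝓝 0) :=
    tendsto_zero_of_mul_sq_le hκ
      (fun k => le_trans (le_add_of_nonneg_left (by positivity)) (hdesc x₀ y₀ hx₀ hy₀ k)) hdiff
  have hd : Tendsto (fun k => x (k + 1) - x k) atTop (𝓝 0) :=
    (tendsto_add_atTop_iff_nat (f := fun k => x (k + 1) - x k) 1).mp hd'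
  have hRd : Tendsto (fun k => R (x (k + 1) - x k)) atTop (𝓝 0) := by
    have h := (R.continuous.tendsto 0).comp hd
    rwa [map_zero] at h
  have hRd' : Tendsto (fun k => R (x (k + 2) - x (k + 1))) atTop (𝓝 0) := by
    have h := (R.continuous.tendsto 0).comp hd'
    rwa [map_zero] at h
  have he : Tendsto (fun k => l k - l (k + 1) + (1 / 2 : ℝ) • R (x (k + 2) - x (k + 1)))
      atTop (𝓝 0) :=
    tendsto_zero_of_mul_sq_le (half_pos hμ)
      (fun k => le_trans (le_add_of_nonneg_right (by positivity)) (hdesc x₀ y₀ hx₀ hy₀ k)) hdiff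
  -- The dual increment is recovered from the vanishing shifted combination `he` by removing the
  -- R-terms, which vanish with the primal increments.
  have hdy : Tendsto (fun k => y (k + 1) - y k) atTop (𝓝 0) := by
    have h := ((he.sub (hRd'.const_smul (1 / 2 : ℝ))).sub (hRd.sub hRd')).neg
    simp only [smul_zero, sub_zero, neg_zero] at h
    refine h.congr fun k => ?_
    simp only [l]
    abel
  have hbdd : ∀ k, (l k - y₀, x (k + 1) - x₀) ∈
      Metric.closedBall (0 : F × E) (Real.sqrt (2 / μ * V x₀ y₀ 0)) := fun k => by
    have h := (hVlow x₀ y₀ k).trans (hanti x₀ y₀ hx₀ hy₀ (Nat.zero_le k))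
    rw [mem_closedBall_zero_iff, Prod.norm_def, max_le_iff]
    have e₁ : 0 ≤ μ / 2 * ‖l k - y₀‖ ^ 2 := by positivity
    have e₂ : 0 ≤ μ / 2 * ‖x (k + 1) - x₀‖ ^ 2 := by positivity
    constructor <;> apply Real.le_sqrt_of_sq_le <;>
      rw [div_mul_eq_mul_div, le_div_iff₀ hμ] <;> dsimp only <;> linarith
  obtain ⟨⟨w, u⟩, -, φ, hφ, hconv⟩ := tendsto_subseq_of_bounded Metric.isBounded_closedBall hbdd
  have hφ' := hφ.tendsto_atTop
  rw [nhds_prod_eq, tendsto_prod_iff'] at hconv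
  set xs := u + x₀ with hxs
  set ys := w + y₀ with hys
  have hx1 : Tendsto (fun j => x (φ j + 1)) atTop (𝓝 xs) := by
    simpa using hconv.2.add_const x₀
  have hl : Tendsto (fun j => l (φ j)) atTop (𝓝 ys) := by
    simpa using hconv.1.add_const y₀
  have hdφ := hd.comp hφ'
  have hdyφ := hdy.comp hφ'
  have hx0 : Tendsto (fun j => x (φ j)) atTop (𝓝 xs) := by
    simpa [Function.comp_def] using hx1.sub hdφ
  have hy0 : Tendsto (fun j => y (φ j)) atTop (𝓝 ys) := by
    simpa [Function.comp_def, l] using hl.sub (hRd.comp hφ')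
  have hy1 : Tendsto (fun j => y (φ j + 1)) atTop (𝓝 ys) := by
    simpa [Function.comp_def] using hdyφ.add hy0
  have hxsA : (xs, -Kt ys) ∈ A := by
    refine hA.mem_of_tendsto (hx1.prodMk_nhds ?_) (Eventually.of_forall fun j => hx (φ j))
    have h := (((Kt.continuous.tendsto ys).comp hy0).neg).sub
      (((P.continuous.tendsto 0).comp hdφ).sub
        (((S.continuous.tendsto 0).comp hdφ).const_smul (1 / 2 : ℝ)))
    simpa using h
  have hysB : (ys, K xs) ∈ B := by
    refine hB.mem_of_tendsto (hy1.prodMk_nhds ?_) (Eventually.of_forall fun j => hy (φ j))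
    have h := ((K.continuous.tendsto _).comp ((hx1.const_smul (2 : ℝ)).sub hx0)).sub
      ((M.continuous.tendsto 0).comp hdyφ)
    rwa [two_smul, add_sub_cancel_right, map_zero, sub_zero] at h
  -- The energy is now centred at the cluster point itself: it converges by monotonicity, and its
  -- subsequential limit is 0 by continuity.
  have hV : Tendsto (V xs ys) atTop (𝓝 0) := by
    obtain ⟨a, ha⟩ := hlim xs ys hxsA hysB
    have hcont : Continuous fun q : E × E × F => energy P S M K R q.1 q.2.1 q.2.2 := by
      unfold energy
      fun_prop
    have h := (hcont.tendsto ((xs - xs, xs - xs, ys - ys) : E × E × F)).comp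
      ((hx0.sub_const xs).prodMk_nhds ((hx1.sub_const xs).prodMk_nhds (hy0.sub_const ys)))
    have h0 : energy P S M K R (xs - xs) (xs - xs) (ys - ys) = 0 := by simp [energy]
    have h' : Tendsto (V xs ys ∘ φ) atTop (𝓝 0) := by
      rw [← h0]
      exact h
    rwa [tendsto_nhds_unique h' (ha.comp hφ')]
  refine ⟨xs, ys, ⟨hxsA, hysB⟩, ?_, ?_⟩
  · have h := tendsto_zero_of_mul_sq_le (half_pos hμ)
      (fun k => le_trans (le_add_of_nonneg_left (by positivity)) (hVlow xs ys k)) hV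
    have h' := h.add_const xs
    simp only [sub_add_cancel, zero_add] at h'
    exact (tendsto_add_atTop_iff_nat 1).mp h'
  · have h := tendsto_zero_of_mul_sq_le (half_pos hμ)
      (fun k => le_trans (le_add_of_nonneg_right (by positivity)) (hVlow xs ys k)) hV
    simpa [l] using (h.add_const ys).sub hRd

end Convergence

/-! ### Subdifferentials, conjugates and saddle points -/

section ConvexAnalysis

variable {m n : ℕ}

theorem ProperClosedConvex.isClosed_epigraph {f : Vec n → EReal} (hf : ProperClosedConvex f) :
    IsClosed {p : Vec n × ℝ | f p.1 ≤ (p.2 : EReal)} :=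
  hf.closed.isClosed_epigraph.preimage
    (continuous_fst.prodMk (continuous_coe_real_ereal.comp continuous_snd))

theorem ProperClosedConvex.exists_real {f : Vec n → EReal} (hf : ProperClosedConvex f) {x : Vec n}
    (hx : f x ≠ ⊤) : ∃ r : ℝ, f x = r :=
  ⟨(f x).toReal, (EReal.coe_toReal hx (hf.ne_bot x)).symm⟩

/-- Testing against real upper bounds turns each condition into membership of a point in the
epigraph, depending continuously on x and ξ; closedness of the graph follows. -/
theorem ProperClosedConvex.mem_subdiff_iff {f : Vec n → EReal} (hf : ProperClosedConvex f)
    {x ξ : Vec n} :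
    ξ ∈ subdiff f x ↔ ∀ z, ∀ r : ℝ, f z ≤ r → f x ≤ ((r - inner ℝ ξ (z - x) : ℝ) : EReal) := by
  constructor
  · rintro ⟨hx, h⟩ z r hr
    obtain ⟨s, hs⟩ := hf.exists_real hx
    have h' := (h z).trans hr
    rw [hs] at h' ⊢
    norm_cast at h' ⊢
    linarith
  · intro h
    obtain ⟨z₀, hz₀⟩ := hf.exists_ne_top
    obtain ⟨r₀, hr₀⟩ := hf.exists_real hz₀
    have hx : f x ≠ ⊤ := ne_top_of_le_ne_top (EReal.coe_ne_top _) (h z₀ r₀ hr₀.le)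
    obtain ⟨s, hs⟩ := hf.exists_real hx
    refine ⟨hx, fun z => ?_⟩
    by_cases hz : f z = ⊤
    · rw [hz]
      exact le_top
    obtain ⟨r, hr⟩ := hf.exists_real hz
    have h' := h z r hr.le
    rw [hs] at h' ⊢
    rw [hr]
    norm_cast at h' ⊢
    linarith

theorem ProperClosedConvex.isClosed_subdiff_graph {f : Vec n → EReal}
    (hf : ProperClosedConvex f) : IsClosed {p : Vec n × Vec n | p.2 ∈ subdiff f p.1} := by
  simp only [hf.mem_subdiff_iff, Set.ofPred_forall]
  refine isClosed_iInter fun z => isClosed_iInter fun r => isClosed_iInter fun _ => ?_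
  exact hf.isClosed_epigraph.preimage
    (f := fun p : Vec n × Vec n => (p.1, r - inner ℝ p.2 (z - p.1))) (by fun_prop)

theorem ProperClosedConvex.subdiff_mono {f : Vec n → EReal} (hf : ProperClosedConvex f)
    {x₁ x₂ ξ₁ ξ₂ : Vec n} (h₁ : ξ₁ ∈ subdiff f x₁) (h₂ : ξ₂ ∈ subdiff f x₂) :
    0 ≤ inner ℝ (ξ₁ - ξ₂) (x₁ - x₂) := by
  obtain ⟨r₁, hr₁⟩ := hf.exists_real h₁.1
  obtain ⟨r₂, hr₂⟩ := hf.exists_real h₂.1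
  have e₁ := h₁.2 x₂
  have e₂ := h₂.2 x₁
  rw [hr₁, hr₂] at e₁ e₂
  norm_cast at e₁ e₂
  simp only [inner_sub_left, inner_sub_right] at e₁ e₂ ⊢
  linarith

/-- Fermat's rule for the sum of a convex function and a quadratic one. -/
theorem ProperClosedConvex.neg_mem_subdiff_of_isMinOn {f : Vec n → EReal}
    (hf : ProperClosedConvex f) {q C : Vec n → ℝ} {x a : Vec n}
    (hq : ∀ (t : ℝ) v, q (x + t • v) = q x + t * inner ℝ a v + t ^ 2 * C v)
    (hmin : IsMinOn (fun z => f z + (q z : EReal)) Set.univ x) : -a ∈ subdiff f x := by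
  have hmin' : ∀ z, f x + (q x : EReal) ≤ f z + (q z : EReal) := fun z => hmin (Set.mem_univ z)
  have hx : f x ≠ ⊤ := by
    obtain ⟨z₀, hz₀⟩ := hf.exists_ne_top
    obtain ⟨r₀, hr₀⟩ := hf.exists_real hz₀
    intro hx
    have h := hmin' z₀
    rw [hx, hr₀, EReal.top_add_coe, ← EReal.coe_add] at h
    exact EReal.coe_ne_top _ (top_le_iff.mp h)
  refine ⟨hx, fun z => ?_⟩
  by_cases hz : f z = ⊤
  · rw [hz]
    exact le_top
  obtain ⟨r, hr⟩ := hf.exists_real hz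
  obtain ⟨s, hs⟩ := hf.exists_real hx
  -- Compare x with x + t(z - x), use convexity of f and divide by t. The quadratic term vanishes as
  -- t → 0, so C needs no sign and M₁ may be indefinite.
  have key : ∀ t ∈ Set.Ioc (0 : ℝ) 1, 0 ≤ r - s + inner ℝ a (z - x) + t * C (z - x) := by
    intro t ht
    have hc := hf.convex (x := (x, s)) hs.le (y := (z, r)) hr.le
      (sub_nonneg.mpr ht.2) ht.1.le (sub_add_cancel 1 t)
    have e : (1 - t) • x + t • z = x + t • (z - x) := by module
    simp only [Prod.smul_mk, Prod.mk_add_mk, Set.mem_ofPred_eq, smul_eq_mul, e] at hc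
    have h := (hmin' (x + t • (z - x))).trans (add_le_add_left hc _)
    rw [hs, hq] at h
    norm_cast at h
    refine nonneg_of_mul_nonneg_right ?_ ht.1
    linarith
  have hlim : Tendsto (fun t : ℝ => r - s + inner ℝ a (z - x) + t * C (z - x)) (𝓝[>] 0)
      (𝓝 (r - s + inner ℝ a (z - x) + 0 * C (z - x))) :=
    (Continuous.tendsto (by fun_prop) 0).mono_left nhdsWithin_le_nhds
  have h := ge_of_tendsto hlim
    (Filter.mem_of_superset (Ioc_mem_nhdsGT one_pos) fun t ht => key t ht)
  rw [hr, hs]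
  norm_cast
  rw [inner_neg_left]
  linarith

theorem ProperClosedConvex.conj_le_iff {g : Vec m → EReal} (hg : ProperClosedConvex g) {y : Vec m}
    {r : ℝ} : conj g y ≤ r ↔ ∀ z, ∀ s : ℝ, g z ≤ s → inner ℝ z y - s ≤ r := by
  rw [conj, iSup_le_iff]
  refine forall_congr' fun z => ?_
  by_cases hz : g z = ⊤
  · simp [hz]
  · obtain ⟨c, hc⟩ := hg.exists_real hz
    rw [hc]
    norm_cast
    exact ⟨fun h s hs => by linarith [hs], fun h => h c le_rfl⟩

/-- A proper closed convex function has an affine minorant: separate its epigraph from a point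
strictly below it. The slope of the minorant lies in the domain of the conjugate. -/
theorem ProperClosedConvex.conj_ne_top {g : Vec m → EReal} (hg : ProperClosedConvex g) :
    ∃ y, conj g y ≠ ⊤ := by
  obtain ⟨z₀, hz₀⟩ := hg.exists_ne_top
  obtain ⟨r₀, hr₀⟩ := hg.exists_real hz₀
  obtain ⟨φ, u, hu, hepi⟩ := geometric_hahn_banach_point_closed (x := (z₀, r₀ - 1)) hg.convex
    hg.isClosed_epigraph (by
      simp only [Set.mem_ofPred_eq, hr₀, EReal.coe_le_coe_iff]
      linarith)
  have hφ : ∀ z r, φ (z, r) = φ (z, 0) + r * φ (0, 1) := fun z r => by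
    rw [← smul_eq_mul, ← map_smul, ← map_add]
    simp
  -- The hyperplane is not vertical, since it separates two points over the same `z₀`.
  have hs : 0 < φ (0, 1) := by
    have h := hu.trans (hepi (z₀, r₀) hr₀.le)
    rw [hφ, hφ z₀ r₀] at h
    linarith
  set s := φ (0, 1)
  let w : Vec m := (InnerProductSpace.toDual ℝ (Vec m)).symm
    (φ.comp (ContinuousLinearMap.inl ℝ (Vec m) ℝ))
  have hw : ∀ z, inner ℝ w z = φ (z, 0) := fun z => by
    rw [InnerProductSpace.toDual_symm_apply]
    simp
  refine ⟨-s⁻¹ • w, ne_top_of_le_ne_top (EReal.coe_ne_top (-(s⁻¹ * u)))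
    (hg.conj_le_iff.mpr fun z r hr => ?_)⟩
  have h := hepi (z, r) hr
  rw [hφ] at h
  rw [real_inner_smul_right, real_inner_comm, hw]
  have h' := mul_lt_mul_of_pos_left h (inv_pos.mpr hs)
  rw [mul_add, mul_comm r, inv_mul_cancel_left₀ hs.ne'] at h'
  linarith

theorem ProperClosedConvex.conj {g : Vec m → EReal} (hg : ProperClosedConvex g) :
    ProperClosedConvex (conj g) where
  ne_bot y := by
    obtain ⟨z₀, hz₀⟩ := hg.exists_ne_top
    obtain ⟨r₀, hr₀⟩ := hg.exists_real hz₀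
    have h := le_iSup (fun z : Vec m => ((inner ℝ z y : ℝ) : EReal) - g z) z₀
    simp only [hr₀, ← EReal.coe_sub] at h
    exact ne_bot_of_le_ne_bot (EReal.coe_ne_bot _) h
  exists_ne_top := hg.conj_ne_top
  closed := by
    refine lowerSemicontinuous_iSup fun z => Continuous.lowerSemicontinuous ?_
    by_cases hz : g z = ⊤
    · simpa [hz] using continuous_const
    · obtain ⟨c, hc⟩ := hg.exists_real hz
      simp only [hc, ← EReal.coe_sub]
      exact continuous_coe_real_ereal.comp (by fun_prop)
  convex := by
    simp only [hg.conj_le_iff, Set.ofPred_forall]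
    refine convex_iInter fun z => convex_iInter fun s => convex_iInter fun _ => ?_
    rintro ⟨y₁, r₁⟩ h₁ ⟨y₂, r₂⟩ h₂ a b ha hb hab
    simp only [Set.mem_ofPred_eq, Prod.smul_mk, Prod.mk_add_mk, inner_add_right,
      real_inner_smul_right, smul_eq_mul] at h₁ h₂ ⊢
    have e₁ := mul_le_mul_of_nonneg_left h₁ ha
    have e₂ := mul_le_mul_of_nonneg_left h₂ hb
    have e₃ : s = a * s + b * s := by rw [← add_mul, hab, one_mul]
    linarith

theorem inner_act_transpose (K : Matrix (Fin m) (Fin n) ℝ) (u : Vec n) (w : Vec m) :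
    inner ℝ (act K.transpose w) u = inner ℝ w (act K u) := by
  have h := Matrix.toEuclideanLin_conjTranspose_eq_adjoint K
  rw [Matrix.conjTranspose_eq_transpose_of_trivial] at h
  rw [act, act, h, LinearMap.adjoint_inner_left]

/-- Once the values at the saddle point are known to be finite, the common finite terms cancel and
each saddle inequality is a subgradient inequality. Finiteness comes from testing against points of
the two domains. -/
theorem isSaddle_iff {f : Vec n → EReal} {g : Vec m → EReal} (hf : ProperClosedConvex f)
    (hg : ProperClosedConvex g) (K : Matrix (Fin m) (Fin n) ℝ) {xs : Vec n} {ys : Vec m} :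
    IsSaddle f g K xs ys ↔
      -act K.transpose ys ∈ subdiff f xs ∧ act K xs ∈ subdiff (conj g) ys := by
  have hh := hg.conj
  constructor
  · rintro ⟨h₁, h₂⟩
    obtain ⟨x₀, hx₀⟩ := hf.exists_ne_top
    obtain ⟨y₀, hy₀⟩ := hh.exists_ne_top
    obtain ⟨r₀, hr₀⟩ := hf.exists_real hx₀
    obtain ⟨s₀, hs₀⟩ := hh.exists_real hy₀
    unfold lagrangian at h₁ h₂
    have hys : conj g ys ≠ ⊤ := fun hys => by
      have h := h₁ y₀
      rw [hys, hs₀, EReal.sub_top, le_bot_iff] at h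
      have hxs := hf.ne_bot xs
      induction hfx : f xs with
      | bot => exact hxs hfx
      | top => simp [hfx] at h
      | coe r =>
        rw [hfx] at h
        norm_cast at h
    obtain ⟨s, hs⟩ := hh.exists_real hys
    have hxs : f xs ≠ ⊤ := fun hxs => by
      have h := h₂ x₀
      rw [hxs, hr₀, hs, EReal.top_add_coe, EReal.top_sub_coe, top_le_iff] at h
      norm_cast at h
      exact EReal.coe_ne_top _ h
    obtain ⟨r, hr⟩ := hf.exists_real hxs
    refine ⟨⟨hxs, fun z => ?_⟩, hys, fun w => ?_⟩
    · by_cases hz : f z = ⊤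
      · rw [hz]
        exact le_top
      obtain ⟨c, hc⟩ := hf.exists_real hz
      have h := h₂ z
      rw [hr, hs, hc] at h
      rw [hr, hc, inner_neg_left, inner_act_transpose, ← real_inner_comm, act, map_sub, ← act,
        ← act, inner_sub_left]
      norm_cast at h ⊢
      linarith
    · by_cases hw : conj g w = ⊤
      · rw [hw]
        exact le_top
      obtain ⟨c, hc⟩ := hh.exists_real hw
      have h := h₁ w
      rw [hr, hs, hc] at h
      rw [hs, hc, inner_sub_right]
      norm_cast at h ⊢
      linarith
  · rintro ⟨⟨hxs, h₂⟩, hys, h₁⟩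
    obtain ⟨r, hr⟩ := hf.exists_real hxs
    obtain ⟨s, hs⟩ := hh.exists_real hys
    unfold IsSaddle lagrangian
    refine ⟨fun w => ?_, fun z => ?_⟩
    · by_cases hw : conj g w = ⊤
      · rw [hw, EReal.sub_top]
        exact bot_le
      obtain ⟨c, hc⟩ := hh.exists_real hw
      have h := h₁ w
      rw [hs, hc, inner_sub_right] at h
      rw [hr, hs, hc]
      norm_cast at h ⊢
      linarith
    · by_cases hz : f z = ⊤
      · rw [hz, hs, EReal.top_add_coe, EReal.top_sub_coe]
        exact le_top
      obtain ⟨c, hc⟩ := hf.exists_real hz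
      have h := h₂ z
      rw [hr, hc, inner_neg_left, inner_act_transpose, ← real_inner_comm, act, map_sub, ← act,
        ← act, inner_sub_left] at h
      rw [hr, hs, hc]
      norm_cast at h ⊢
      linarith

end ConvexAnalysis

/-! ### Matrix square roots, coercivity and optimality conditions -/

section Matrices

variable {l m n : ℕ}

/-- `act A` as a continuous linear map. -/
def actL (A : Matrix (Fin m) (Fin n) ℝ) : Vec n →L[ℝ] Vec m :=
  LinearMap.toContinuousLinearMap (Matrix.toEuclideanLin A)

theorem actL_apply (A : Matrix (Fin m) (Fin n) ℝ) (z : Vec n) : actL A z = act A z := rfl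

theorem actL_mul (A : Matrix (Fin l) (Fin m) ℝ) (B : Matrix (Fin m) (Fin n) ℝ) (z : Vec n) :
    actL (A * B) z = actL A (actL B z) := by
  simp only [actL_apply, act, Matrix.toEuclideanLin, Matrix.toLpLin_mul (q := 2),
    LinearMap.comp_apply]

theorem actL_add (A B : Matrix (Fin m) (Fin n) ℝ) (z : Vec n) :
    actL (A + B) z = actL A z + actL B z := by
  simp only [actL_apply, act, map_add, LinearMap.add_apply]

theorem actL_smul (c : ℝ) (A : Matrix (Fin m) (Fin n) ℝ) (z : Vec n) :
    actL (c • A) z = c • actL A z := by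
  simp only [actL_apply, act, map_smul, LinearMap.smul_apply]

theorem actL_one (z : Vec n) : actL 1 z = z := by
  simp [actL_apply, act]

theorem inner_actL_comm {M : Matrix (Fin n) (Fin n) ℝ} (hM : M.IsSymm) (u v : Vec n) :
    inner ℝ u (actL M v) = inner ℝ v (actL M u) := by
  have h := inner_act_transpose M u v
  rw [hM] at h
  rw [actL_apply, actL_apply, ← h, real_inner_comm]

theorem invSqrt_inv_mul_self {M : Matrix (Fin n) (Fin n) ℝ} (hM : M.PosDef) :
    (invSqrt M)⁻¹ * (invSqrt M)⁻¹ = M := by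
  rw [← Matrix.mul_inv_rev, invSqrt_mul_self hM, Matrix.nonsing_inv_nonsing_inv]
  exact (Matrix.isUnit_iff_isUnit_det M).mp hM.isUnit

theorem isUnit_det_invSqrt {M : Matrix (Fin n) (Fin n) ℝ} (hM : M.PosDef) :
    IsUnit (invSqrt M).det := by
  have h : IsUnit (M⁻¹).det := (Matrix.isUnit_iff_isUnit_det _).mp hM.inv.isUnit
  rw [← invSqrt_mul_self hM, Matrix.det_mul] at h
  exact isUnit_of_mul_isUnit_left h

theorem isSymm_invSqrt (M : Matrix (Fin n) (Fin n) ℝ) : (invSqrt M).IsSymm := by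
  have h := (invSqrt_posSemidef M).isHermitian
  rwa [Matrix.IsHermitian, Matrix.conjTranspose_eq_transpose_of_trivial] at h

theorem inner_actL_mul_self {B : Matrix (Fin n) (Fin n) ℝ} (hB : B.IsSymm) (u : Vec n) :
    inner ℝ u (actL (B * B) u) = ‖actL B u‖ ^ 2 := by
  rw [actL_mul, inner_actL_comm hB, real_inner_self_eq_norm_sq]

theorem inner_actL_eq_norm_sq {M : Matrix (Fin n) (Fin n) ℝ} (hM : M.PosDef) (u : Vec n) :
    inner ℝ u (actL M u) = ‖actL (invSqrt M)⁻¹ u‖ ^ 2 := by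
  rw [← inner_actL_mul_self (isSymm_invSqrt M).inv, invSqrt_inv_mul_self hM]

theorem actL_invSqrt_inv {M : Matrix (Fin n) (Fin n) ℝ} (hM : M.PosDef) (u : Vec n) :
    actL (invSqrt M) (actL (invSqrt M)⁻¹ u) = u := by
  rw [← actL_mul, Matrix.mul_nonsing_inv _ (isUnit_det_invSqrt hM), actL_one]

theorem exists_coercive {M : Matrix (Fin n) (Fin n) ℝ} (hM : M.PosDef) :
    ∃ μ : ℝ, 0 < μ ∧ ∀ u, μ * ‖u‖ ^ 2 ≤ inner ℝ u (actL M u) := by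
  -- The bound comes from u = M^{-1/2}(M^{1/2}u); the added 1 keeps the constant positive even in
  -- dimension 0.
  refine ⟨(‖actL (invSqrt M)‖ ^ 2 + 1)⁻¹, by positivity, fun u => ?_⟩
  rw [inner_actL_eq_norm_sq hM, inv_mul_le_iff₀ (by positivity)]
  have h := (actL (invSqrt M)).le_opNorm (actL (invSqrt M)⁻¹ u)
  rw [actL_invSqrt_inv hM] at h
  have h' := pow_le_pow_left₀ (norm_nonneg u) h 2
  rw [mul_pow] at h'
  have := sq_nonneg ‖actL (invSqrt M)⁻¹ u‖
  linarith

/-- With v = P^{1/2}u, the left side is ‖M^{-1/2}KP^{-1/2}v‖² and the quadratic form of P at u is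
‖v‖². -/
theorem inner_actL_inv_le {P : Matrix (Fin n) (Fin n) ℝ} {M : Matrix (Fin m) (Fin m) ℝ}
    (hP : P.PosDef) (hM : M.PosDef) (K : Matrix (Fin m) (Fin n) ℝ) (u : Vec n) :
    inner ℝ (actL K u) (actL (M⁻¹ * K) u) ≤
      spectralNorm (invSqrt M * K * invSqrt P) ^ 2 * inner ℝ u (actL P u) := by
  rw [actL_mul, ← invSqrt_mul_self hM, inner_actL_mul_self (isSymm_invSqrt M),
    inner_actL_eq_norm_sq hP, ← mul_pow]
  have h := (actL (invSqrt M * K * invSqrt P)).le_opNorm (actL (invSqrt P)⁻¹ u)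
  rw [actL_mul, actL_invSqrt_inv hP, actL_mul] at h
  exact pow_le_pow_left₀ (norm_nonneg _) h 2

theorem ProperClosedConvex.mem_subdiff_of_isMinOn_quadratic {f : Vec n → EReal}
    (hf : ProperClosedConvex f) {M : Matrix (Fin n) (Fin n) ℝ} (hM : M.IsSymm) {b x x' : Vec n}
    (hmin : IsMinOn (fun z => f z + ((inner ℝ b z + 1 / 2 * normSqM M (z - x) : ℝ) : EReal))
      Set.univ x') :
    -b - actL M (x' - x) ∈ subdiff f x' := by
  have h := hf.neg_mem_subdiff_of_isMinOn (a := b + actL M (x' - x))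
    (C := fun v => 1 / 2 * normSqM M v) (fun t v => ?_) hmin
  · rwa [neg_add'] at h
  · rw [add_sub_right_comm]
    simp only [normSqM, ← actL_apply, map_add, map_smul, inner_add_left, inner_add_right,
      real_inner_smul_left, real_inner_smul_right]
    rw [inner_actL_comm hM (x' - x) v, real_inner_comm v (actL M _)]
    ring

/-- The subdifferential at a point is closed, so distance zero is attained; infinite distance to the
empty set rules that case out. -/
theorem ProperClosedConvex.mem_subdiff_of_infEDist_eq_zero {f : Vec n → EReal}
    (hf : ProperClosedConvex f) {x a : Vec n}
    (h : Metric.infEDist 0 ((fun ξ => ξ + a) '' subdiff f x) = 0) : -a ∈ subdiff f x := by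
  have hcl : IsClosed (subdiff f x) :=
    hf.isClosed_subdiff_graph.preimage (f := fun ξ : Vec n => (x, ξ)) (by fun_prop)
  obtain ⟨ξ, hξ, h0⟩ := (Metric.mem_iff_infEDist_zero_of_closed
    ((Homeomorph.addRight a).isClosedMap _ hcl)).mpr h
  rwa [← eq_neg_of_add_eq_zero_left (show ξ + a = 0 from h0)]

end Matrices

/-- Every update of a generated sequence, stopped or not, solves the optimality inclusions. -/
theorem IsGenerated.inclusions {m n : ℕ} {f : Vec n → EReal} {g : Vec m → EReal}
    {K : Matrix (Fin m) (Fin n) ℝ} (hf : ProperClosedConvex f) (hg : ProperClosedConvex g)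
    {M₁ : Matrix (Fin n) (Fin n) ℝ} {M₂ : Matrix (Fin m) (Fin m) ℝ} (hM₁ : M₁.IsSymm)
    (hM₂ : M₂.IsSymm) {x : ℕ → Vec n} {y : ℕ → Vec m} (h : IsGenerated f g K M₁ M₂ 0 x y) (k : ℕ) :
    -actL K.transpose (y k) - actL M₁ (x (k + 1) - x k) ∈ subdiff f (x (k + 1)) ∧
      actL K ((2 : ℝ) • x (k + 1) - x k) - actL M₂ (y (k + 1) - y k)
        ∈ subdiff (conj g) (y (k + 1)) := by
  rcases h k with ⟨h₁, h₂⟩ | ⟨-, hres, hx, hy⟩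
  · constructor
    · refine hf.mem_subdiff_of_isMinOn_quadratic hM₁ ?_
      simpa only [actL_apply, inner_act_transpose, real_inner_comm (y k)] using h₁
    · have h := hg.conj.mem_subdiff_of_isMinOn_quadratic (x := y k)
        (b := -actL K ((2 : ℝ) • x (k + 1) - x k)) hM₂ (by simpa only [inner_neg_left, actL_apply] using h₂)
      rwa [neg_neg] at h
  -- At a stop the increments are zero, so the update inclusions reduce to the KKT inclusions.
  · rw [kktResidual, ENNReal.coe_zero, max_le_iff, nonpos_iff_eq_zero, nonpos_iff_eq_zero] at hres
    have h₁ := hf.mem_subdiff_of_infEDist_eq_zero hres.1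
    have h₂ := hg.conj.mem_subdiff_of_infEDist_eq_zero (a := -act K (x k))
      (by simpa only [sub_eq_add_neg] using hres.2)
    rw [neg_neg] at h₂
    rw [hx, hy, sub_self, sub_self, map_zero, map_zero, sub_zero, sub_zero, two_smul,
      add_sub_cancel_right]
    exact ⟨h₁, h₂⟩

end PrePDHG

end

theorem theorem3p1 {m n : ℕ} (f : PrePDHG.Vec n → EReal) (g : PrePDHG.Vec m → EReal)
    (K : Matrix (Fin m) (Fin n) ℝ)
    (hf : PrePDHG.ProperClosedConvex f) (hg : PrePDHG.ProperClosedConvex g)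
    (hsaddle : ∃ xs ys, PrePDHG.IsSaddle f g K xs ys)
    (S : Matrix (Fin n) (Fin n) ℝ) (hS : PrePDHG.IsMonotonicityMatrix f S)
    (M₁ : Matrix (Fin n) (Fin n) ℝ) (M₂ : Matrix (Fin m) (Fin m) ℝ)
    (hM₁symm : M₁.IsSymm) (hM₂symm : M₂.IsSymm)
    (hM₁ : (M₁ + (1 / 2 : ℝ) • S).PosDef) (hM₂ : M₂.PosDef)
    (hnorm : PrePDHG.spectralNorm
      (PrePDHG.invSqrt M₂ * K * PrePDHG.invSqrt (M₁ + (1 / 2 : ℝ) • S)) ^ 2 < 4 / 3)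
    (x : ℕ → PrePDHG.Vec n) (y : ℕ → PrePDHG.Vec m)
    (hxy : PrePDHG.IsGenerated f g K M₁ M₂ 0 x y) :
    ∃ xs ys, PrePDHG.IsSaddle f g K xs ys ∧
      Tendsto x atTop (𝓝 xs) ∧ Tendsto y atTop (𝓝 ys) := by
  open PrePDHG in
  have hSsymm : S.IsSymm := by
    have h := hS.posSemidef.isHermitian
    rwa [Matrix.IsHermitian, Matrix.conjTranspose_eq_transpose_of_trivial] at h
  have hPsymm : (M₁ + (1 / 2 : ℝ) • S).IsSymm := hM₁symm.add (hSsymm.smul _)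
  obtain ⟨μ₁, hμ₁, hcoe₁⟩ := exists_coercive hM₁
  obtain ⟨μ₂, hμ₂, hcoe₂⟩ := exists_coercive hM₂
  have hinc := hxy.inclusions hf hg hM₁symm hM₂symm
  have hdet : IsUnit M₂.det := (Matrix.isUnit_iff_isUnit_det _).mp hM₂.isUnit
  simp only [isSaddle_iff hf hg] at hsaddle ⊢
  -- With P = M₁ + S/2, the abstract preconditioner P - S/2 is M₁; `c` is the squared spectral norm.
  refine tendsto_of_monotone_inclusion (A := {p | p.2 ∈ subdiff f p.1})
    (B := {p | p.2 ∈ subdiff (conj g) p.1}) (P := actL (M₁ + (1 / 2 : ℝ) • S)) (S := actL S)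
    (M := actL M₂) (K := actL K) (R := actL (M₂⁻¹ * K)) (Kt := actL K.transpose)
    (μ := min μ₁ μ₂) hf.isClosed_subdiff_graph hg.conj.isClosed_subdiff_graph
    (fun p hp q hq => hS.monotone _ _ _ _ hp hq) (fun p hp q hq => hg.conj.subdiff_mono hp hq)
    (inner_act_transpose K) (inner_actL_comm hPsymm) (inner_actL_comm hSsymm)
    (inner_actL_comm hM₂symm) (fun u => ?_) (lt_min hμ₁ hμ₂) hnorm
    (fun u => le_trans (by gcongr; exact min_le_left _ _) (hcoe₁ u))
    (fun u => le_trans (by gcongr; exact min_le_right _ _) (hcoe₂ u))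
    (fun u => ?_) (inner_actL_inv_le hM₁ hM₂ K) hsaddle (fun k => ?_) (fun k => (hinc k).2)
  · rw [← actL_mul, Matrix.mul_nonsing_inv_cancel_left _ _ hdet]
  · have h := hS.posSemidef.dotProduct_mulVec_nonneg u.ofLp
    simpa [actL_apply, act, EuclideanSpace.inner_eq_star_dotProduct, dotProduct_comm] using h
  · have h := (hinc k).1
    rwa [Set.mem_ofPred_eq, actL_add, actL_smul, add_sub_cancel_right]
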